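/- Let $N>1$ be an integer and $\alpha>0$, and let $h:\mathbb R\to\mathbb R$ satisfy (i) $h\in C^1(\mathbb R)$, $h(0)=0$, and $h(t)>0$ for $t>0$; (ii) $h$ is odd, and convex on $[0,\infty)$; and the Keller–Osserman condition $$\int_a^\infty F(s)^{-1/2}\,ds<\infty\quad\text{for every } a>0,\qquad\text{where } F(s)=\int_0^s h(t)\,dt .$$ Then there is a constant $C=C(N,\alpha,h)>0$, depending only on $N$, $\alpha$ and $h$, such that the following holds for every open set $\Omega\subsetneq\mathbb R^N$ (in particular, for every domain of class $C^2$ with non-empty boundary), where $\rho(x)=\operatorname{dist}(x,\partial\Omega)$. Every solution $u$ of $$-\Delta u+\rho^{-2-\alpha}\,h(\rho^{\alpha}u)=0\quad\text{in }\Omega$$ satisfies $$|u(x)|\le C\,\rho(x)^{-\alpha}\quad\text{for almost every }x\in\Omega .$$ Here a solution is a real-valued function $u$ such that $u$ and $\rho^{-2-\alpha}h(\rho^{\alpha}u)$ are locally integrable in $\Omega$ and the equation holds in the sense of distributions in $\Omega$, i.e. $\int_\Omega\bigl(-u\,\Delta\varphi+\rho^{-2-\alpha}h(\rho^{\alpha}u)\,\varphi\bigr)\,dx=0$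 for every $\varphi\in C_c^\infty(\Omega)$. -/

import Mathlib

open MeasureTheory Set

noncomputable section

namespace SimilarityElliptic

/-- `ρ(x) = dist(x, ∂Ω)`. -/
def rho {N : ℕ} (Ω : Set (EuclideanSpace ℝ (Fin N))) (x : EuclideanSpace ℝ (Fin N)) : ℝ :=
  Metric.infDist x (frontier Ω)

/-- `H(ρ(x), t) = ρ(x)^{-2-α} h(ρ(x)^α t)`, as a function of `x` and `t`. -/
def absorption {N : ℕ} (Ω : Set (EuclideanSpace ℝ (Fin N))) (α : ℝ) (h : ℝ → ℝ)
    (x : EuclideanSpace ℝ (Fin N)) (t : ℝ) : ℝ :=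
  rho Ω x ^ (-2 - α) * h (rho Ω x ^ α * t)

/-- `u` is a solution of `-Δu + g(x, u) = 0` in `Ω`: `u` and `x ↦ g(x, u(x))` are locally integrable
in `Ω`, and the equation holds in the sense of distributions, that is, when tested against every
`φ ∈ C_c^∞(Ω)`. -/
structure IsSolution {N : ℕ} (Ω : Set (EuclideanSpace ℝ (Fin N)))
    (g : EuclideanSpace ℝ (Fin N) → ℝ → ℝ) (u : EuclideanSpace ℝ (Fin N) → ℝ) : Prop where
  locallyIntegrableOn : LocallyIntegrableOn u Ω volume
  locallyIntegrableOn_comp : LocallyIntegrableOn (fun x => g x (u x)) Ω volume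
  integral_eq_zero : ∀ φ : EuclideanSpace ℝ (Fin N) → ℝ,
    ContDiff ℝ (⊤ : ℕ∞) φ → HasCompactSupport φ → tsupport φ ⊆ Ω →
      ∫ x in Ω, (-(u x * Laplacian.laplacian φ x) + g x (u x) * φ x) = 0

/-- The structural conditions on `h`: it is `C¹`, vanishes at `0`, is positive on `(0, ∞)`, odd, and
convex on `[0, ∞)`. -/
structure IsNonlinearity (h : ℝ → ℝ) : Prop where
  contDiff : ContDiff ℝ 1 h
  map_zero : h 0 = 0
  pos : ∀ t : ℝ, 0 < t → 0 < h t
  convexOn : ConvexOn ℝ (Ici 0) h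
  odd : Function.Odd h

/-- The Keller–Osserman condition: `∫_a^∞ F(s)^{-1/2} ds < ∞` for all `a > 0`, where
`F(s) = ∫_0^s f(t) dt`. -/
def KellerOsserman (f : ℝ → ℝ) : Prop :=
  ∀ a : ℝ, 0 < a →
    IntegrableOn (fun s : ℝ => (∫ t in (0 : ℝ)..s, f t) ^ (-(1 / 2) : ℝ)) (Ioi a) volume

end SimilarityElliptic

end

open Filter Topology

namespace SimilarityElliptic

/-! The proof is the Keller–Osserman argument, adapted to distributional solutions and made scale
invariant. Fix a point of `Ω` at distance `r` from the boundary. On the ball of radius `r/2` about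
it, `ρ` lies between `r/2` and `3r/2`, so the weights in the equation are frozen up to constants.
Kato's inequality (`HasWeakLaplacian.kato`) and the oddness of `h` turn the equation into `Δ|u| ≥ A
h(k|u|)` in the weak sense, with `k = (r/2)^α` and `A = (3r/2)^(-2-α)`. Mollifying `k|u|` and
applying Jensen's inequality to the convex `h` gives a smooth `V` with `ΔV ≥ k A h(V)` where `V > 0`
(`IsNonlinearity.mul_map_le_laplaceSum_mollify`). By scaling, `k A` is a constant, depending only on
`α`, times `r^(-2)`.

The bound on smooth subsolutions is `IsNonlinearity.exists_center_bound`. Instead of constructing a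
boundary blow-up supersolution, it composes `V` with the tail `T(s) = ∫_s^∞ F^(-1/2)`, a positive
decreasing function tending to `0`. If `V` is very large at the centre of a ball of radius `R`, then
`T(V)` lies below the paraboloid `l(1 - |x - x₀|²/R²)` there but above it on the boundary sphere.
The difference thus has an interior minimum, where the derivative tests contradict the lower bound
for `ΔV` if `l` is small. The resulting bound `M` depends on neither `R` nor `V`, so it passes to
the almost everywhere limit of the mollifications and bounds `k|u|`. -/

/-- The `i`-th partial derivative. -/
noncomputable def partialDeriv {N : ℕ} (i : Fin N) (f : EuclideanSpace ℝ (Fin N) → ℝ)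
    (x : EuclideanSpace ℝ (Fin N)) : ℝ :=
  fderiv ℝ f x (EuclideanSpace.single i 1)

/-- The Laplacian written as the sum of the pure second partial derivatives. -/
noncomputable def laplaceSum {N : ℕ} (f : EuclideanSpace ℝ (Fin N) → ℝ)
    (x : EuclideanSpace ℝ (Fin N)) : ℝ :=
  ∑ i, partialDeriv i (partialDeriv i f) x

/-! ### Coordinate calculus and the second-derivative test -/

section Calculus

variable {N : ℕ} {f : EuclideanSpace ℝ (Fin N) → ℝ}

theorem contDiff_partialDeriv {n : WithTop ℕ∞} {m : WithTop ℕ∞} (hf : ContDiff ℝ n f)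
    (hmn : m + 1 ≤ n) (i : Fin N) : ContDiff ℝ m (partialDeriv i f) :=
  (hf.fderiv_right hmn).clm_apply contDiff_const

theorem laplacian_eq_laplaceSum (hf : ContDiff ℝ 2 f) :
    Laplacian.laplacian f = laplaceSum f := by
  rw [InnerProductSpace.laplacian_eq_iteratedFDeriv_orthonormalBasis f
    (EuclideanSpace.basisFun (Fin N) ℝ)]
  funext x
  refine Finset.sum_congr rfl fun i _ => ?_
  have h1 : DifferentiableAt ℝ (fderiv ℝ f) x :=
    ((hf.fderiv_right (m := 1) (by norm_num)).differentiable (by norm_num)) x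
  have : partialDeriv i f = fun y => fderiv ℝ f y (EuclideanSpace.single i 1) := rfl
  rw [iteratedFDeriv_two_apply, SimilarityElliptic.partialDeriv, this,
    fderiv_clm_apply h1 (differentiableAt_const _)]
  simp

theorem hasDerivAt_line (hf : Differentiable ℝ f) (x : EuclideanSpace ℝ (Fin N)) (i : Fin N)
    (s : ℝ) :
    HasDerivAt (fun s : ℝ => f (x + s • EuclideanSpace.single i (1 : ℝ)))
      (partialDeriv i f (x + s • EuclideanSpace.single i (1 : ℝ))) s := by
  have h1 : HasDerivAt (fun s : ℝ => x + s • EuclideanSpace.single i (1 : ℝ))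
      (EuclideanSpace.single i (1 : ℝ)) s := by
    simpa using ((hasDerivAt_id s).smul_const (EuclideanSpace.single i (1 : ℝ))).const_add x
  exact (hf _).hasFDerivAt.comp_hasDerivAt s h1

end Calculus

/-- Second-order necessary condition for a local minimum on the line. -/
theorem nonneg_of_isLocalMin_of_hasDerivAt {φ ψ : ℝ → ℝ} {s a : ℝ} (hmin : IsLocalMin φ s)
    (hφ : ∀ᶠ t in 𝓝 s, HasDerivAt φ (ψ t) t) (hψ : HasDerivAt ψ a s) : 0 ≤ a := by
  by_contra! ha
  have hd : deriv φ =ᶠ[𝓝 s] ψ := hφ.mono fun t ht => ht.deriv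
  have h2 : deriv (deriv φ) s = a := by rw [hd.deriv_eq, hψ.deriv]
  -- A negative second derivative would make `s` a local maximum as well, so `φ` would be locally
  -- constant and its second derivative zero.
  have hmax : IsLocalMax φ s := isLocalMax_of_deriv_deriv_neg (by rw [h2]; exact ha)
    hmin.deriv_eq_zero hφ.self_of_nhds.continuousAt
  have hc : φ =ᶠ[𝓝 s] fun _ => φ s := by
    filter_upwards [hmin, hmax] with t h1 h2 using le_antisymm h2 h1
  have h3 : deriv φ =ᶠ[𝓝 s] fun _ => 0 := by
    filter_upwards [hc.eventuallyEq_nhds] with t ht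
    rw [ht.deriv_eq]; simp
  rw [h3.deriv_eq] at h2
  simp at h2
  exact ha.ne h2.symm

/-! ### The nonlinearity, its primitive and the Keller–Osserman tail -/

section Nonlinearity

variable {h : ℝ → ℝ}

theorem IsNonlinearity.continuous (hh : IsNonlinearity h) : Continuous h := hh.contDiff.continuous

theorem IsNonlinearity.nonneg (hh : IsNonlinearity h) {t : ℝ} (ht : 0 ≤ t) : 0 ≤ h t := by
  rcases ht.eq_or_lt with rfl | ht
  · exact hh.map_zero.ge
  · exact (hh.pos t ht).le

/-- Convexity together with `h 0 = 0` makes `h(s)/s` nondecreasing; this is that fact with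
denominators cleared. -/
theorem IsNonlinearity.mul_le (hh : IsNonlinearity h) {s t : ℝ} (hs : 0 ≤ s) (hst : s ≤ t) :
    t * h s ≤ s * h t := by
  rcases hs.eq_or_lt with rfl | hs
  · simp [hh.map_zero]
  have ht : 0 < t := hs.trans_le hst
  have := hh.convexOn.2 (mem_Ici.2 ht.le) (mem_Ici.2 le_rfl)
    (show 0 ≤ s / t by positivity)
    (show 0 ≤ 1 - s / t by rw [sub_nonneg, div_le_one ht]; exact hst) (by ring)
  simp only [smul_eq_mul, hh.map_zero, mul_zero, add_zero] at this
  rw [div_mul_cancel₀ _ ht.ne'] at this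
  calc t * h s ≤ t * (s / t * h t) := by gcongr
    _ = s * h t := by field_simp

theorem IsNonlinearity.monotoneOn (hh : IsNonlinearity h) : MonotoneOn h (Ici 0) := by
  intro s hs t ht hst
  rcases (mem_Ici.1 ht).eq_or_lt with h0 | h0
  · have : s = t := le_antisymm hst (h0 ▸ hs)
    rw [this]
  have h1 := hh.mul_le hs hst
  have h2 : s * h t ≤ t * h t := mul_le_mul_of_nonneg_right hst (hh.nonneg ht)
  exact le_of_mul_le_mul_left (h1.trans h2) h0

/-- The primitive of `h` vanishing at `0`. -/
noncomputable def primitive (h : ℝ → ℝ) (s : ℝ) : ℝ := ∫ t in (0 : ℝ)..s, h t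

theorem IsNonlinearity.hasDerivAt_primitive (hh : IsNonlinearity h) (s : ℝ) :
    HasDerivAt (primitive h) (h s) s :=
  intervalIntegral.integral_hasDerivAt_right (hh.continuous.intervalIntegrable _ _)
    hh.continuous.aestronglyMeasurable.stronglyMeasurableAtFilter hh.continuous.continuousAt

theorem IsNonlinearity.primitive_pos (hh : IsNonlinearity h) {s : ℝ} (hs : 0 < s) :
    0 < primitive h s :=
  intervalIntegral.intervalIntegral_pos_of_pos_on (hh.continuous.intervalIntegrable _ _)
    (fun t ht => hh.pos t ht.1) hs

theorem IsNonlinearity.primitive_le (hh : IsNonlinearity h) {s : ℝ} (hs : 0 ≤ s) :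
    primitive h s ≤ s * h s := by
  have : primitive h s ≤ ∫ _t in (0 : ℝ)..s, h s :=
    intervalIntegral.integral_mono_on hs (hh.continuous.intervalIntegrable _ _)
      intervalIntegrable_const fun t ht => hh.monotoneOn ht.1 hs ht.2
  simpa using this

/-- For `s ≥ 1` the primitive is controlled by the square of `h`. -/
theorem IsNonlinearity.sqrt_mul_sqrt_primitive_le (hh : IsNonlinearity h) {s : ℝ} (hs : 1 ≤ s) :
    √(h 1) * √(primitive h s) ≤ h s := by
  have h0 : 0 ≤ h s := hh.nonneg (by linarith)
  rw [← Real.sqrt_mul (hh.nonneg zero_le_one)]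
  refine Real.sqrt_le_iff.2 ⟨h0, ?_⟩
  have h1 := hh.primitive_le (s := s) (by linarith)
  have h2 := hh.mul_le zero_le_one hs
  calc h 1 * primitive h s ≤ h 1 * (s * h s) :=
        mul_le_mul_of_nonneg_left h1 (hh.nonneg zero_le_one)
    _ = (s * h 1) * h s := by ring
    _ ≤ (1 * h s) * h s := by gcongr
    _ = h s ^ 2 := by ring

/-- The Keller–Osserman weight `F^{-1/2}`, frozen below `1`. -/
noncomputable def weight (h : ℝ → ℝ) (s : ℝ) : ℝ := (√(primitive h (max s 1)))⁻¹

theorem IsNonlinearity.weight_pos (hh : IsNonlinearity h) (s : ℝ) : 0 < weight h s :=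
  inv_pos.2 (Real.sqrt_pos.2 (hh.primitive_pos (by positivity)))

theorem IsNonlinearity.continuous_weight (hh : IsNonlinearity h) : Continuous (weight h) := by
  have h1 : Continuous (primitive h) :=
    continuous_iff_continuousAt.2 fun s => (hh.hasDerivAt_primitive s).continuousAt
  refine Continuous.inv₀ (by fun_prop) fun s => ?_
  exact (Real.sqrt_pos.2 (hh.primitive_pos (by positivity))).ne'

/-- In the barrier argument, this lower bound lets the term `h w`, with `w` the weight, dominate the
constant produced by the Laplacian of the paraboloid. -/
theorem IsNonlinearity.sqrt_le_mul_weight (hh : IsNonlinearity h) {s : ℝ} (hs : 1 ≤ s) :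
    √(h 1) ≤ h s * weight h s := by
  rw [weight, max_eq_left hs, ← div_eq_mul_inv,
    le_div_iff₀ (Real.sqrt_pos.2 (hh.primitive_pos (by positivity)))]
  exact hh.sqrt_mul_sqrt_primitive_le hs

theorem IsNonlinearity.hasDerivAt_weight (hh : IsNonlinearity h) {s : ℝ} (hs : 1 < s) :
    HasDerivAt (weight h) (-(h s * weight h s ^ 3 / 2)) s := by
  have hp := hh.primitive_pos (s := s) (by positivity)
  have h1 : HasDerivAt (fun t => (√(primitive h t))⁻¹) _ s :=
    ((hh.hasDerivAt_primitive s).sqrt hp.ne').inv (Real.sqrt_pos.2 hp).ne'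
  have h2 : weight h =ᶠ[𝓝 s] fun t => (√(primitive h t))⁻¹ := by
    filter_upwards [lt_mem_nhds hs] with t ht
    rw [weight, max_eq_left ht.le]
  refine (h1.congr_of_eventuallyEq h2).congr_deriv ?_
  rw [weight, max_eq_left hs.le]
  have := (Real.sqrt_pos.2 hp).ne'
  field_simp

theorem IsNonlinearity.integrableOn_weight (hh : IsNonlinearity h) (hKO : KellerOsserman h) :
    IntegrableOn (weight h) (Ioi 1) := by
  refine (hKO 1 one_pos).congr_fun (fun s hs => ?_) measurableSet_Ioi
  have h0 := (hh.primitive_pos (zero_lt_one.trans (mem_Ioi.1 hs))).le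
  rw [weight, max_eq_left (le_of_lt (mem_Ioi.1 hs)), Real.sqrt_eq_rpow, ← Real.rpow_neg h0,
    primitive]

/-- The Keller–Osserman tail `∫_s^∞ F^{-1/2}`. -/
noncomputable def tail (h : ℝ → ℝ) (s : ℝ) : ℝ :=
  (∫ t in Ioi 1, weight h t) - ∫ t in (1 : ℝ)..s, weight h t

theorem IsNonlinearity.hasDerivAt_tail (hh : IsNonlinearity h) (s : ℝ) :
    HasDerivAt (tail h) (-weight h s) s :=
  (intervalIntegral.integral_hasDerivAt_right (hh.continuous_weight.intervalIntegrable _ _)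
    hh.continuous_weight.aestronglyMeasurable.stronglyMeasurableAtFilter
    hh.continuous_weight.continuousAt).const_sub _

theorem IsNonlinearity.tendsto_tail (hh : IsNonlinearity h) (hKO : KellerOsserman h) : Tendsto (tail h) atTop (𝓝 0) := by
  have := (intervalIntegral_tendsto_integral_Ioi 1 (hh.integrableOn_weight hKO)
    tendsto_id).const_sub (∫ t in Ioi 1, weight h t)
  rw [sub_self] at this
  exact this

theorem IsNonlinearity.strictAnti_tail (hh : IsNonlinearity h) : StrictAnti (tail h) :=
  strictAnti_of_deriv_neg fun s => by
    rw [(hh.hasDerivAt_tail s).deriv]; exact neg_lt_zero.2 (hh.weight_pos s)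

theorem IsNonlinearity.tail_pos (hh : IsNonlinearity h) (hKO : KellerOsserman h) (s : ℝ) :
    0 < tail h s :=
  (hh.strictAnti_tail.antitone.le_of_tendsto (hh.tendsto_tail hKO) (s + 1)).trans_lt
    (hh.strictAnti_tail (lt_add_one s))

end Nonlinearity

/-! ### Comparison of the tail of a subsolution with a paraboloid -/

section Barrier

variable {N : ℕ} {h : ℝ → ℝ} {V : EuclideanSpace ℝ (Fin N) → ℝ}

theorem norm_sq_line (y : EuclideanSpace ℝ (Fin N)) (i : Fin N) (s : ℝ) :
    ‖y + s • EuclideanSpace.single i (1 : ℝ)‖ ^ 2 = ‖y‖ ^ 2 + 2 * s * y i + s ^ 2 := by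
  rw [norm_add_sq_real, inner_smul_right, norm_smul]
  simp [EuclideanSpace.inner_single_right]
  ring

/-- At a local minimum of `tail h ∘ V - l * (1 - |x - x₀|² / R²)` where `V > 1`, the Laplacian of
`V` is small. -/
theorem IsNonlinearity.weight_mul_laplaceSum_le (hh : IsNonlinearity h) (hV : ContDiff ℝ 2 V)
    {l R : ℝ} {x₀ x₁ : EuclideanSpace ℝ (Fin N)} (h1 : 1 < V x₁)
    (hmin : IsLocalMin (fun x => tail h (V x) - l * (1 - ‖x - x₀‖ ^ 2 / R ^ 2)) x₁) :
    weight h (V x₁) * laplaceSum V x₁ ≤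
      h (V x₁) * weight h (V x₁) / 2 * (2 * l / R ^ 2) ^ 2 * ‖x₁ - x₀‖ ^ 2 +
        N * (2 * l / R ^ 2) := by
  have hd : Differentiable ℝ V := hV.differentiable (by norm_num)
  have key : ∀ i : Fin N, weight h (V x₁) * partialDeriv i (partialDeriv i V) x₁ ≤
      h (V x₁) * weight h (V x₁) / 2 * (2 * l / R ^ 2) ^ 2 * ((x₁ - x₀) i) ^ 2 +
        2 * l / R ^ 2 := by
    intro i
    set e : EuclideanSpace ℝ (Fin N) := EuclideanSpace.single i (1 : ℝ) with he
    have hd' : Differentiable ℝ (partialDeriv i V) :=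
      (contDiff_partialDeriv hV (m := 1) (by norm_num) i).differentiable (by norm_num)
    have hv := fun s => hasDerivAt_line hd x₁ i s
    have hv' := hasDerivAt_line hd' x₁ i 0
    rw [← he] at hv'
    simp only [← he] at hv
    have hmin' : IsLocalMin (fun s : ℝ => tail h (V (x₁ + s • e)) -
        l * (1 - (‖x₁ - x₀‖ ^ 2 + 2 * s * (x₁ - x₀) i + s ^ 2) / R ^ 2)) 0 := by
      have hc : Tendsto (fun s : ℝ => x₁ + s • e) (𝓝 0) (𝓝 x₁) := by
        have : Continuous fun s : ℝ => x₁ + s • e := by fun_prop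
        simpa using this.tendsto 0
      have := hc.eventually hmin
      refine this.mono fun s hs => ?_
      have h2 := norm_sq_line (x₁ - x₀) i s
      rw [← he, show x₁ - x₀ + s • e = x₁ + s • e - x₀ by abel] at h2
      simpa [h2] using hs
    have hφ : ∀ s : ℝ, HasDerivAt (fun s : ℝ => tail h (V (x₁ + s • e)) -
        l * (1 - (‖x₁ - x₀‖ ^ 2 + 2 * s * (x₁ - x₀) i + s ^ 2) / R ^ 2))
        (-weight h (V (x₁ + s • e)) * partialDeriv i V (x₁ + s • e) +
          l * ((2 * (x₁ - x₀) i + 2 * s) / R ^ 2)) s := by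
      intro s
      have ha := (hh.hasDerivAt_tail (V (x₁ + s • e))).comp s (hv s)
      have hb : HasDerivAt (fun s : ℝ => l * (1 - (‖x₁ - x₀‖ ^ 2 + 2 * s * (x₁ - x₀) i + s ^ 2)
          / R ^ 2)) (l * (-((2 * (x₁ - x₀) i + 2 * s) / R ^ 2))) s := by
        have h3 : HasDerivAt (fun s : ℝ => ‖x₁ - x₀‖ ^ 2 + 2 * s * (x₁ - x₀) i + s ^ 2)
            (2 * (x₁ - x₀) i + 2 * s) s := by
          have := (((((hasDerivAt_id s).const_mul 2).mul_const ((x₁ - x₀) i)).const_add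
            (‖x₁ - x₀‖ ^ 2)).add ((hasDerivAt_id s).pow 2))
          refine this.congr_deriv ?_
          simp
        exact ((h3.div_const _).const_sub 1).const_mul l
      exact (ha.sub hb).congr_deriv (by ring)
    have h0 : (fun s : ℝ => V (x₁ + s • e)) 0 = V x₁ := by simp
    have hw := hh.hasDerivAt_weight (s := V (x₁ + (0 : ℝ) • e)) (by simpa using h1)
    have hψ : HasDerivAt (fun s : ℝ => -weight h (V (x₁ + s • e)) * partialDeriv i V (x₁ + s • e) +
          l * ((2 * (x₁ - x₀) i + 2 * s) / R ^ 2)) _ 0 :=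
      ((hw.comp (0 : ℝ) (hv 0)).neg.mul hv').add
        (((((hasDerivAt_id (0 : ℝ)).const_mul 2).const_add (2 * (x₁ - x₀) i)).div_const
          (R ^ 2)).const_mul l)
    have hp := nonneg_of_isLocalMin_of_hasDerivAt hmin' (Eventually.of_forall hφ) hψ
    -- The first-order condition replaces the unknown gradient of `V` by the explicit gradient of
    -- the paraboloid in the second-order inequality `hp`.
    have hq : -weight h (V x₁) * partialDeriv i V x₁ + l * (2 * (x₁ - x₀) i / R ^ 2) = 0 := by
      have := hmin'.hasDerivAt_eq_zero (hφ 0)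
      simpa using this
    simp only [zero_smul, add_zero, Function.comp, mul_one, Pi.neg_apply] at hp
    set w := weight h (V x₁)
    set D := partialDeriv i V x₁
    have hD : (w * D) ^ 2 = (2 * l / R ^ 2) ^ 2 * ((x₁ - x₀) i) ^ 2 := by
      have : w * D = l * (2 * (x₁ - x₀) i / R ^ 2) := by linarith
      rw [this]; ring
    have : h (V x₁) * w / 2 * (2 * l / R ^ 2) ^ 2 * ((x₁ - x₀) i) ^ 2 =
        h (V x₁) * w / 2 * (w * D) ^ 2 := by rw [hD]; ring
    rw [this]
    have e2 : l * (2 / R ^ 2) = 2 * l / R ^ 2 := by ring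
    rw [e2] at hp
    linarith
  have hs : ‖x₁ - x₀‖ ^ 2 = ∑ i, ((x₁ - x₀) i) ^ 2 := by
    rw [EuclideanSpace.norm_sq_eq]; simp
  rw [laplaceSum, Finset.mul_sum, hs, Finset.mul_sum]
  refine (Finset.sum_le_sum fun i _ => key i).trans_eq ?_
  rw [Finset.sum_add_distrib]
  simp

/-- The Keller–Osserman bound at the centre of a ball, uniform in the ball and the subsolution. -/
theorem IsNonlinearity.exists_center_bound (hh : IsNonlinearity h) (hKO : KellerOsserman h)
    (N : ℕ) {c : ℝ} (hc : 0 < c) :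
    ∃ M : ℝ, 0 < M ∧ ∀ (R : ℝ) (x₀ : EuclideanSpace ℝ (Fin N))
      (V : EuclideanSpace ℝ (Fin N) → ℝ), 0 < R → ContDiff ℝ 2 V →
      (∀ x ∈ Metric.ball x₀ R, 1 < V x → c / R ^ 2 * h (V x) ≤ laplaceSum V x) → V x₀ ≤ M := by
  have hq : 0 < √(h 1) := Real.sqrt_pos.2 (hh.pos 1 one_pos)
  set q := √(h 1)
  -- Three smallness requirements: `l ≤ tail h 1` forces `V > 1` at the minimum, `l ≤ √c / 2`
  -- absorbs the gradient term into half of `c * p`, and the last keeps `2 * N * l` below `c * q /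
  -- 2`. The `N + 1` avoids a zero denominator and makes that bound strict.
  set l : ℝ := min (tail h 1) (min (√c / 2) (c * q / (4 * (N + 1)))) with hl
  have hl1 : l ≤ tail h 1 := min_le_left _ _
  have hl2 : l ≤ √c / 2 := (min_le_right _ _).trans (min_le_left _ _)
  have hl3 : l ≤ c * q / (4 * (N + 1)) := (min_le_right _ _).trans (min_le_right _ _)
  have hl0 : 0 < l := lt_min (hh.tail_pos hKO 1)
    (lt_min (by have := Real.sqrt_pos.2 hc; positivity) (by positivity))
  -- `M` is where the tail has dropped below `l`, the height of the paraboloid at its centre.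
  obtain ⟨M, hM, hM0⟩ := (((hh.tendsto_tail hKO).eventually (gt_mem_nhds hl0)).and
    (eventually_gt_atTop 0)).exists
  refine ⟨M, hM0, fun R x₀ V hR hV hsub => ?_⟩
  by_contra! hlt
  set Ψ : EuclideanSpace ℝ (Fin N) → ℝ :=
    fun x => tail h (V x) - l * (1 - ‖x - x₀‖ ^ 2 / R ^ 2) with hΨ
  have hΨc : Continuous Ψ := by
    have h1 : Continuous (tail h) :=
      continuous_iff_continuousAt.2 fun s => (hh.hasDerivAt_tail s).continuousAt
    have h2 := hV.continuous
    fun_prop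
  have hΨ0 : Ψ x₀ < 0 := by
    have := hh.strictAnti_tail hlt
    simp only [hΨ, sub_self, norm_zero]
    simp
    linarith
  obtain ⟨x₁, hx₁, hmin⟩ := (isCompact_closedBall x₀ R).exists_isMinOn
    ⟨x₀, Metric.mem_closedBall_self hR.le⟩ hΨc.continuousOn
  have hneg : Ψ x₁ < 0 := (hmin (Metric.mem_closedBall_self hR.le)).trans_lt hΨ0
  have ht := hh.tail_pos hKO (V x₁)
  have hle : ‖x₁ - x₀‖ ≤ R := by simpa [dist_eq_norm] using hx₁
  -- On the sphere the paraboloid vanishes and `Ψ` equals the positive tail, so a negative minimum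
  -- is interior.
  have hlt' : ‖x₁ - x₀‖ < R := by
    refine lt_of_le_of_ne hle fun heq => ?_
    simp only [hΨ, heq] at hneg
    rw [div_self (by positivity)] at hneg
    linarith
  have hball : x₁ ∈ Metric.ball x₀ R := by simpa [dist_eq_norm] using hlt'
  have h1 : 1 < V x₁ := by
    rw [← hh.strictAnti_tail.lt_iff_gt]
    have : 0 ≤ l * (‖x₁ - x₀‖ ^ 2 / R ^ 2) := by positivity
    simp only [hΨ] at hneg
    linarith
  have hloc : IsLocalMin Ψ x₁ := hmin.isLocalMin
    (mem_of_superset (Metric.isOpen_ball.mem_nhds hball) Metric.ball_subset_closedBall)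
  have h2 := hh.weight_mul_laplaceSum_le hV h1 hloc
  have hw := hh.weight_pos (V x₁)
  have h3 := mul_le_mul_of_nonneg_left (hsub x₁ hball h1) hw.le
  have h4 := hh.sqrt_le_mul_weight h1.le
  set p := h (V x₁) * weight h (V x₁)
  have h5 : p / 2 * (2 * l / R ^ 2) ^ 2 * ‖x₁ - x₀‖ ^ 2 ≤
      p / 2 * (2 * l / R ^ 2) ^ 2 * R ^ 2 := by
    have : 0 ≤ p := hq.le.trans h4
    gcongr
  have h6 : c / R ^ 2 * p ≤ p / 2 * (2 * l / R ^ 2) ^ 2 * R ^ 2 + N * (2 * l / R ^ 2) := by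
    have : c / R ^ 2 * p = weight h (V x₁) * (c / R ^ 2 * h (V x₁)) := by ring
    linarith
  -- Multiplying by `R ^ 2` removes the radius altogether, which is why `M` is uniform in `R`.
  have h7 : c * p ≤ 2 * l ^ 2 * p + 2 * N * l := by
    have := mul_le_mul_of_nonneg_left h6 (sq_nonneg R)
    field_simp at this
    linarith
  have h8 : l ^ 2 ≤ c / 4 := by
    calc l ^ 2 ≤ (√c / 2) ^ 2 := by gcongr
      _ = c / 4 := by rw [div_pow, Real.sq_sqrt hc.le]; norm_num
  have h9 : 2 * N * l < c * q / 2 := by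
    rw [le_div_iff₀ (by positivity)] at hl3
    nlinarith
  have h10 : 2 * l ^ 2 * p ≤ c / 2 * p := by
    have : 0 ≤ p := hq.le.trans h4
    gcongr
    linarith
  have h11 : c * q ≤ c * p := by gcongr
  linarith

end Barrier

/-! ### Mollification and its derivatives -/

/-- The convolution of `f` with the kernel `η`. -/
noncomputable def mollify {N : ℕ} (η f : EuclideanSpace ℝ (Fin N) → ℝ)
    (x : EuclideanSpace ℝ (Fin N)) : ℝ :=
  ∫ y, f y * η (x - y)

section Mollify

variable {N : ℕ} {η f g : EuclideanSpace ℝ (Fin N) → ℝ}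

theorem mollify_eq_convolution :
    mollify η f = convolution f η (ContinuousLinearMap.mul ℝ ℝ) volume := rfl

theorem mollify_eq_convolution_lsmul :
    mollify η f = convolution η f (ContinuousLinearMap.lsmul ℝ ℝ) volume := by
  funext x
  rw [convolution_eq_swap]
  exact integral_congr_ae (Eventually.of_forall fun y => by simp [mul_comm])

theorem hasCompactSupport_partialDeriv (hη : HasCompactSupport η) (i : Fin N) :
    HasCompactSupport (partialDeriv i η) :=
  hη.fderiv_apply ℝ _

theorem tsupport_partialDeriv_subset (i : Fin N) : tsupport (partialDeriv i η) ⊆ tsupport η :=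
  tsupport_fderiv_apply_subset ℝ _

theorem contDiff_laplaceSum {m n : WithTop ℕ∞} (hf : ContDiff ℝ n f) (hmn : m + 1 + 1 ≤ n) :
    ContDiff ℝ m (laplaceSum f) :=
  ContDiff.sum fun i _ => contDiff_partialDeriv (contDiff_partialDeriv hf hmn i) le_rfl i

theorem tsupport_laplaceSum_subset : tsupport (laplaceSum η) ⊆ tsupport η := by
  refine closure_minimal (fun x hx => ?_) (isClosed_tsupport η)
  by_contra hn
  refine hx (Finset.sum_eq_zero fun i _ => image_eq_zero_of_notMem_tsupport fun h => hn ?_)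
  exact tsupport_partialDeriv_subset i (tsupport_partialDeriv_subset i h)

theorem hasCompactSupport_laplaceSum (hη : HasCompactSupport η) :
    HasCompactSupport (laplaceSum η) :=
  IsCompact.of_isClosed_subset hη (isClosed_tsupport _) tsupport_laplaceSum_subset

theorem contDiff_mollify {n : ℕ∞} (hη : HasCompactSupport η) (hη' : ContDiff ℝ n η)
    (hf : LocallyIntegrable f) : ContDiff ℝ n (mollify η f) :=
  hη.contDiff_convolution_right (ContinuousLinearMap.mul ℝ ℝ) hf hη'

theorem partialDeriv_mollify (hη : HasCompactSupport η) (hη' : ContDiff ℝ 1 η)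
    (hf : LocallyIntegrable f) (i : Fin N) :
    partialDeriv i (mollify η f) = mollify (partialDeriv i η) f := by
  funext x
  rw [partialDeriv, mollify_eq_convolution,
    (hη.hasFDerivAt_convolution_right (ContinuousLinearMap.mul ℝ ℝ) hf hη' x).fderiv,
    convolution_precompR_apply _ hf (hη.fderiv ℝ) (hη'.continuous_fderiv one_ne_zero)]
  rfl

theorem integrable_mul_kernel (hη : HasCompactSupport η) (hη' : Continuous η)
    (hf : LocallyIntegrable f) (x : EuclideanSpace ℝ (Fin N)) :
    Integrable fun y => f y * η (x - y) :=
  hη.convolutionExists_right (ContinuousLinearMap.mul ℝ ℝ) hf hη' x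

theorem laplaceSum_mollify (hη : HasCompactSupport η) (hη' : ContDiff ℝ 2 η)
    (hf : LocallyIntegrable f) :
    laplaceSum (mollify η f) = mollify (laplaceSum η) f := by
  funext x
  have h1 : ∀ i : Fin N, ContDiff ℝ 1 (partialDeriv i η) := fun i =>
    contDiff_partialDeriv hη' (by norm_num) i
  have h0 : ContDiff ℝ 1 η := hη'.of_le (by norm_num)
  have e : laplaceSum (mollify η f) x =
      ∑ i, mollify (partialDeriv i (partialDeriv i η)) f x := by
    simp only [laplaceSum, partialDeriv_mollify hη h0 hf,
      partialDeriv_mollify (hasCompactSupport_partialDeriv hη _) (h1 _) hf]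
  rw [e]
  simp only [mollify]
  simp only [laplaceSum, Finset.mul_sum]
  rw [integral_finsetSum]
  intro i _
  refine integrable_mul_kernel ?_ ?_ hf x
  · exact hasCompactSupport_partialDeriv (hasCompactSupport_partialDeriv hη i) i
  · exact (contDiff_partialDeriv (h1 i) (m := 0) (by norm_num) i).continuous

theorem partialDeriv_comp_const_sub (hη : Differentiable ℝ η) (x : EuclideanSpace ℝ (Fin N))
    (i : Fin N) :
    partialDeriv i (fun y => η (x - y)) = fun y => -partialDeriv i η (x - y) := by
  funext y
  have h1 : HasFDerivAt (fun y => η (x - y)) _ y :=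
    (hη (x - y)).hasFDerivAt.comp y ((hasFDerivAt_id y).const_sub x)
  simp only [partialDeriv]
  rw [h1.fderiv]
  simp

theorem laplaceSum_comp_const_sub (hη : ContDiff ℝ 2 η) (x : EuclideanSpace ℝ (Fin N)) :
    laplaceSum (fun y => η (x - y)) = fun y => laplaceSum η (x - y) := by
  funext y
  refine Finset.sum_congr rfl fun i _ => ?_
  have hd : Differentiable ℝ (partialDeriv i η) :=
    (contDiff_partialDeriv hη (m := 1) (by norm_num) i).differentiable one_ne_zero
  rw [partialDeriv_comp_const_sub (hη.differentiable two_ne_zero)]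
  have : partialDeriv i (fun y => -partialDeriv i η (x - y)) y =
      -partialDeriv i (fun y => partialDeriv i η (x - y)) y := by
    simp only [partialDeriv]
    rw [fderiv_fun_neg]; simp
  rw [this, partialDeriv_comp_const_sub hd]
  simp

theorem tsupport_comp_const_sub_subset {r : ℝ} (hη : tsupport η ⊆ Metric.closedBall 0 r)
    (x : EuclideanSpace ℝ (Fin N)) :
    tsupport (fun y => η (x - y)) ⊆ Metric.closedBall x r := by
  refine closure_minimal (fun y hy => ?_) Metric.isClosed_closedBall
  have := hη (subset_tsupport η hy)
  rwa [mem_closedBall_zero_iff, ← dist_eq_norm, dist_comm] at this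

theorem integrable_mollify (hη : Integrable η) (hf : Integrable f) : Integrable (mollify η f) :=
  hf.integrable_convolution (ContinuousLinearMap.mul ℝ ℝ) hη

theorem integral_mollify (hη : Integrable η) (hf : Integrable f) :
    ∫ x, mollify η f x = (∫ x, f x) * ∫ x, η x :=
  integral_convolution (ContinuousLinearMap.mul ℝ ℝ) hf hη

end Mollify

/-! ### Approximate identities and convergence in `L¹` -/

section ApproximateIdentity

variable {N : ℕ} {f : EuclideanSpace ℝ (Fin N) → ℝ}

/-- Scheffé's lemma. -/
theorem tendsto_integral_abs_sub_of_nonneg {X : Type*} [MeasurableSpace X] {μ : Measure X}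
    {F : ℕ → X → ℝ} {f : X → ℝ} (hF : ∀ n, Integrable (F n) μ) (hf : Integrable f μ)
    (hF0 : ∀ n x, 0 ≤ F n x) (hf0 : ∀ x, 0 ≤ f x) (hint : ∀ n, ∫ x, F n x ∂μ = ∫ x, f x ∂μ)
    (hlim : ∀ᵐ x ∂μ, Tendsto (fun n => F n x) atTop (𝓝 (f x))) :
    Tendsto (fun n => ∫ x, |F n x - f x| ∂μ) atTop (𝓝 0) := by
  -- Since `F n` and `f` have equal integrals, the positive and negative parts of their difference
  -- have equal mass; the part `(f - F n)⁺` is dominated by `f`.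
  have h1 : ∀ n, ∫ x, |F n x - f x| ∂μ = 2 * ∫ x, max (f x - F n x) 0 ∂μ := by
    intro n
    have e : ∀ x, |F n x - f x| = (F n x - f x) + 2 * max (f x - F n x) 0 := by
      intro x
      rcases le_total (f x) (F n x) with h | h
      · rw [abs_of_nonneg (by linarith), max_eq_right (by linarith)]; ring
      · rw [abs_of_nonpos (by linarith), max_eq_left (by linarith)]; ring
    simp only [e]
    have i1 : Integrable (fun x => F n x - f x) μ := (hF n).sub hf
    have i2 : Integrable (fun x => max (f x - F n x) 0) μ := (hf.sub (hF n)).pos_part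
    rw [integral_add i1 (i2.const_mul 2),
      integral_sub (hF n) hf, hint n, integral_const_mul]
    ring
  have h2 : Tendsto (fun n => ∫ x, max (f x - F n x) 0 ∂μ) atTop (𝓝 (∫ _x, (0 : ℝ) ∂μ)) := by
    refine tendsto_integral_of_dominated_convergence f
      (fun n => ((hf.sub (hF n)).pos_part).aestronglyMeasurable) hf ?_ ?_
    · intro n
      refine Eventually.of_forall fun x => ?_
      rw [Real.norm_eq_abs, abs_of_nonneg (le_max_right _ _)]
      exact max_le (by linarith [hF0 n x]) (hf0 x)
    · filter_upwards [hlim] with x hx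
      have := (hx.const_sub (f x)).max (tendsto_const_nhds (x := (0 : ℝ)))
      simpa using this
  simp only [h1]
  simpa using h2.const_mul 2

/-- A sequence of smooth bump functions whose supports shrink to the origin. -/
noncomputable def bump (N : ℕ) (r : ℝ) (hr : 0 < r) (n : ℕ) :
    ContDiffBump (0 : EuclideanSpace ℝ (Fin N)) where
  rIn := r / (n + 1) / 2
  rOut := r / (n + 1)
  rIn_pos := by positivity
  rIn_lt_rOut := half_lt_self (by positivity)

/-- The corresponding kernels of integral one. -/
noncomputable def kernel (N : ℕ) (r : ℝ) (hr : 0 < r) (n : ℕ) : EuclideanSpace ℝ (Fin N) → ℝ :=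
  (bump N r hr n).normed volume

variable {r : ℝ} (hr : 0 < r)

theorem contDiff_kernel (n : ℕ) {m : ℕ∞} : ContDiff ℝ m (kernel N r hr n) :=
  (bump N r hr n).contDiff_normed

theorem tsupport_kernel (n : ℕ) : tsupport (kernel N r hr n) ⊆ Metric.closedBall 0 r := by
  rw [kernel, ContDiffBump.tsupport_normed_eq]
  refine Metric.closedBall_subset_closedBall (div_le_self hr.le ?_)
  have : (0 : ℝ) ≤ n := n.cast_nonneg
  linarith

theorem hasCompactSupport_kernel (n : ℕ) : HasCompactSupport (kernel N r hr n) :=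
  (bump N r hr n).hasCompactSupport_normed

theorem kernel_nonneg (n : ℕ) (x : EuclideanSpace ℝ (Fin N)) : 0 ≤ kernel N r hr n x :=
  (bump N r hr n).nonneg_normed x

theorem integrable_kernel (n : ℕ) : Integrable (kernel N r hr n) :=
  (contDiff_kernel hr n (m := 0)).continuous.integrable_of_hasCompactSupport
    (hasCompactSupport_kernel hr n)

theorem integral_kernel (n : ℕ) : ∫ x, kernel N r hr n x = 1 :=
  (bump N r hr n).integral_normed

theorem ae_tendsto_mollify (hf : LocallyIntegrable f) :
    ∀ᵐ x, Tendsto (fun n => mollify (kernel N r hr n) f x) atTop (𝓝 (f x)) := by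
  simp only [mollify_eq_convolution_lsmul]
  refine ContDiffBump.ae_convolution_tendsto_right_of_locallyIntegrable (K := 2) ?_ ?_ hf
  · exact tendsto_const_div_atTop_nhds_zero_nat r |>.comp (tendsto_add_atTop_nat 1) |>.congr
      fun n => by simp [bump]
  · refine Eventually.of_forall fun n => ?_
    simp only [bump]
    linarith

/-- Mollification is linear, so splitting `f` into positive and negative parts reduces `L¹`
convergence to nonnegative functions, where Scheffé's lemma applies. -/
theorem abs_mollify_sub_le (n : ℕ) (hf : Integrable f) (x : EuclideanSpace ℝ (Fin N)) :
    |mollify (kernel N r hr n) f x - f x| ≤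
      |mollify (kernel N r hr n) (fun x => max (f x) 0) x - max (f x) 0| +
        |mollify (kernel N r hr n) (fun x => max (-f x) 0) x - max (-f x) 0| := by
  have hc := (contDiff_kernel (N := N) hr n (m := 0)).continuous
  have hsplit : ∀ t : ℝ, t = max t 0 - max (-t) 0 := fun t => by
    rcases le_total 0 t with h | h
    · rw [max_eq_left h, max_eq_right (by linarith)]; ring
    · rw [max_eq_right h, max_eq_left (by linarith)]; ring
  have e : mollify (kernel N r hr n) f x = mollify (kernel N r hr n) (fun x => max (f x) 0) x -
      mollify (kernel N r hr n) (fun x => max (-f x) 0) x := by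
    simp only [mollify]
    rw [← integral_sub
      (integrable_mul_kernel (hasCompactSupport_kernel hr n) hc hf.pos_part.locallyIntegrable x)
      (integrable_mul_kernel (hasCompactSupport_kernel hr n) hc hf.neg_part.locallyIntegrable x)]
    refine integral_congr_ae (Eventually.of_forall fun y => ?_)
    dsimp only
    rw [← sub_mul, ← hsplit]
  have e2 := hsplit (f x)
  generalize max (f x) 0 = p at *
  generalize max (-f x) 0 = q at *
  rw [e, e2, sub_sub_sub_comm]
  exact abs_sub _ _

theorem tendsto_integral_abs_mollify_sub (hf : Integrable f) :
    Tendsto (fun n => ∫ x, |mollify (kernel N r hr n) f x - f x|) atTop (𝓝 0) := by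
  have hi : ∀ (p : EuclideanSpace ℝ (Fin N) → ℝ) (n : ℕ), Integrable p →
      Integrable fun x => |mollify (kernel N r hr n) p x - p x| := fun p n hp =>
    ((integrable_mollify (integrable_kernel (N := N) hr n) hp).sub hp).abs
  have key : ∀ p : EuclideanSpace ℝ (Fin N) → ℝ, Integrable p → (∀ x, 0 ≤ p x) →
      Tendsto (fun n => ∫ x, |mollify (kernel N r hr n) p x - p x|) atTop (𝓝 0) := by
    intro p hp hp0
    refine tendsto_integral_abs_sub_of_nonneg
      (fun n => integrable_mollify (integrable_kernel hr n) hp) hp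
      (fun n x => integral_nonneg fun y => mul_nonneg (hp0 y) (kernel_nonneg hr n _)) hp0
      (fun n => ?_) (ae_tendsto_mollify hr hp.locallyIntegrable)
    rw [integral_mollify (integrable_kernel hr n) hp, integral_kernel, mul_one]
  have hs := (key _ hf.pos_part fun x => le_max_right _ _).add
    (key _ hf.neg_part fun x => le_max_right _ _)
  rw [add_zero] at hs
  refine squeeze_zero (fun n => integral_nonneg fun x => abs_nonneg _) (fun n => ?_) hs
  rw [← integral_add (hi _ n hf.pos_part) (hi _ n hf.neg_part)]
  exact integral_mono (hi _ n hf) ((hi _ n hf.pos_part).add (hi _ n hf.neg_part))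
    fun x => abs_mollify_sub_le hr n hf x

/-- Convergence of integrals of products, one factor converging in `L¹`, the other boundedly a.e. -/
theorem tendsto_integral_mul {X : Type*} [MeasurableSpace X] {μ : Measure X}
    {a : ℕ → X → ℝ} {a₀ : X → ℝ} {b : ℕ → X → ℝ} {b₀ : X → ℝ} {C : ℝ}
    (ha : ∀ n, Integrable (a n) μ) (ha₀ : Integrable a₀ μ)
    (hlim : Tendsto (fun n => ∫ x, |a n x - a₀ x| ∂μ) atTop (𝓝 0))
    (hb : ∀ n, AEStronglyMeasurable (b n) μ) (hC : ∀ n x, |b n x| ≤ C)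
    (hblim : ∀ᵐ x ∂μ, Tendsto (fun n => b n x) atTop (𝓝 (b₀ x))) :
    Tendsto (fun n => ∫ x, a n x * b n x ∂μ) atTop (𝓝 (∫ x, a₀ x * b₀ x ∂μ)) := by
  have hi : ∀ n, ∀ p : X → ℝ, Integrable p μ → Integrable (fun x => p x * b n x) μ :=
    fun n p hp => hp.mul_bdd (hb n) (Eventually.of_forall (hC n))
  have h1 : Tendsto (fun n => ∫ x, (a n x - a₀ x) * b n x ∂μ) atTop (𝓝 0) := by
    have hl := hlim.const_mul C
    rw [mul_zero] at hl
    refine squeeze_zero_norm (fun n => ?_) hl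
    rw [← integral_const_mul]
    refine (norm_integral_le_integral_norm _).trans (integral_mono (hi n _ ((ha n).sub ha₀)).norm
      (((ha n).sub ha₀).abs.const_mul C) fun x => ?_)
    simp only [Real.norm_eq_abs, abs_mul]
    rw [mul_comm]
    exact mul_le_mul_of_nonneg_right (hC n x) (abs_nonneg _)
  have h2 : Tendsto (fun n => ∫ x, a₀ x * b n x ∂μ) atTop (𝓝 (∫ x, a₀ x * b₀ x ∂μ)) := by
    refine tendsto_integral_of_dominated_convergence (fun x => |a₀ x| * C)
      (fun n => (hi n _ ha₀).aestronglyMeasurable) (ha₀.abs.mul_const C) (fun n => ?_) ?_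
    · refine Eventually.of_forall fun x => ?_
      rw [Real.norm_eq_abs, abs_mul]
      exact mul_le_mul_of_nonneg_left (hC n x) (abs_nonneg _)
    · filter_upwards [hblim] with x hx using hx.const_mul _
  have h3 := h1.add h2
  rw [zero_add] at h3
  refine h3.congr fun n => ?_
  rw [← integral_add (hi n (fun x => a n x - a₀ x) ((ha n).sub ha₀)) (hi n _ ha₀)]
  exact integral_congr_ae (Eventually.of_forall fun x => by ring)

end ApproximateIdentity

/-! ### Integration by parts and the chain rule for the Laplacian -/

section IntegrationByParts

variable {N : ℕ} {f ψ : EuclideanSpace ℝ (Fin N) → ℝ}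

theorem integrable_mul_of_hasCompactSupport (hf : Continuous f) (hψ : Continuous ψ)
    (hs : HasCompactSupport ψ) : Integrable fun x => f x * ψ x :=
  (hf.mul hψ).integrable_of_hasCompactSupport hs.mul_left

theorem integral_mul_partialDeriv (hf : ContDiff ℝ 1 f) (hψ : ContDiff ℝ 1 ψ)
    (hs : HasCompactSupport ψ) (i : Fin N) :
    ∫ x, f x * partialDeriv i ψ x = -∫ x, partialDeriv i f x * ψ x := by
  have hf' := (contDiff_partialDeriv hf (m := 0) (by norm_num) i).continuous
  have hψ' := (contDiff_partialDeriv hψ (m := 0) (by norm_num) i).continuous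
  exact integral_mul_fderiv_eq_neg_fderiv_mul_of_integrable
    (integrable_mul_of_hasCompactSupport hf' hψ.continuous hs)
    (integrable_mul_of_hasCompactSupport hf.continuous hψ' (hasCompactSupport_partialDeriv hs i))
    (integrable_mul_of_hasCompactSupport hf.continuous hψ.continuous hs)
    (fun x _ => hf.differentiable one_ne_zero x) (fun x _ => hψ.differentiable one_ne_zero x)

theorem integral_mul_laplaceSum (hf : ContDiff ℝ 2 f) (hψ : ContDiff ℝ 2 ψ)
    (hs : HasCompactSupport ψ) :
    ∫ x, f x * laplaceSum ψ x = ∫ x, laplaceSum f x * ψ x := by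
  have hf1 := fun i => contDiff_partialDeriv hf (m := 1) (by norm_num) i
  have hψ1 := fun i => contDiff_partialDeriv hψ (m := 1) (by norm_num) i
  have hf2 := fun i => (contDiff_partialDeriv (hf1 i) (m := 0) (by norm_num) i).continuous
  have hψ2 := fun i => (contDiff_partialDeriv (hψ1 i) (m := 0) (by norm_num) i).continuous
  have hs1 := fun i => hasCompactSupport_partialDeriv hs i
  simp only [laplaceSum, Finset.mul_sum, Finset.sum_mul]
  rw [integral_finsetSum, integral_finsetSum]
  · refine Finset.sum_congr rfl fun i _ => ?_
    rw [integral_mul_partialDeriv (hf.of_le (by norm_num)) (hψ1 i) (hs1 i),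
      integral_mul_partialDeriv (hf1 i) (hψ.of_le (by norm_num)) hs, neg_neg]
  · exact fun i _ => integrable_mul_of_hasCompactSupport (hf2 i) hψ.continuous hs
  · exact fun i _ => integrable_mul_of_hasCompactSupport hf.continuous (hψ2 i)
      (hasCompactSupport_partialDeriv (hs1 i) i)

theorem partialDeriv_comp {j j' : ℝ → ℝ} (hj : ∀ s, HasDerivAt j (j' s) s)
    (hf : Differentiable ℝ f) (i : Fin N) :
    partialDeriv i (fun x => j (f x)) = fun x => j' (f x) * partialDeriv i f x := by
  funext x
  have h1 : HasFDerivAt (fun x => j (f x)) _ x := (hj (f x)).comp_hasFDerivAt x (hf x).hasFDerivAt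
  simp only [partialDeriv]
  rw [h1.fderiv]
  simp

/-- Convex functions of `f` have Laplacian at least `j'(f) Δ f`. -/
theorem mul_laplaceSum_le_laplaceSum_comp {j j' j'' : ℝ → ℝ} (hj : ∀ s, HasDerivAt j (j' s) s)
    (hj' : ∀ s, HasDerivAt j' (j'' s) s) (hj'' : ∀ s, 0 ≤ j'' s) (hf : ContDiff ℝ 2 f)
    (x : EuclideanSpace ℝ (Fin N)) :
    j' (f x) * laplaceSum f x ≤ laplaceSum (fun x => j (f x)) x := by
  have hd : Differentiable ℝ f := hf.differentiable two_ne_zero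
  rw [laplaceSum, laplaceSum, Finset.mul_sum]
  refine Finset.sum_le_sum fun i _ => ?_
  have hd' : Differentiable ℝ (partialDeriv i f) :=
    (contDiff_partialDeriv hf (m := 1) (by norm_num) i).differentiable one_ne_zero
  rw [partialDeriv_comp hj hd]
  have h1 : HasFDerivAt (fun x => j' (f x) * partialDeriv i f x) _ x :=
    ((hj' (f x)).comp_hasFDerivAt x (hd x).hasFDerivAt).mul (hd' x).hasFDerivAt
  have h2 : partialDeriv i (fun x => j' (f x) * partialDeriv i f x) x =
      j' (f x) * partialDeriv i (partialDeriv i f) x + j'' (f x) * partialDeriv i f x ^ 2 := by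
    conv_lhs => rw [partialDeriv, h1.fderiv]
    simp only [_root_.add_apply, _root_.smul_apply, smul_eq_mul,
      partialDeriv, Function.comp_apply]
    ring
  rw [h2]
  have := mul_nonneg (hj'' (f x)) (sq_nonneg (partialDeriv i f x))
  linarith

end IntegrationByParts

/-! ### Smooth convex approximation of the absolute value -/

section SmoothAbs

/-- A smooth convex approximation of the absolute value. -/
noncomputable def smoothAbs (d s : ℝ) : ℝ := √(s ^ 2 + d ^ 2) - d

/-- The derivative of `smoothAbs`. -/
noncomputable def smoothSign (d s : ℝ) : ℝ := s / √(s ^ 2 + d ^ 2)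

variable {d : ℝ}

theorem hasDerivAt_smoothAbs (hd : 0 < d) (s : ℝ) : HasDerivAt (smoothAbs d) (smoothSign d s) s := by
  have hp : 0 < s ^ 2 + d ^ 2 := by positivity
  have := (((hasDerivAt_pow 2 s).add_const (d ^ 2)).sqrt hp.ne').sub_const d
  refine this.congr_deriv ?_
  rw [smoothSign]
  have := (Real.sqrt_pos.2 hp).ne'
  field_simp
  norm_num

theorem hasDerivAt_smoothSign (hd : 0 < d) (s : ℝ) :
    HasDerivAt (smoothSign d) (d ^ 2 / √(s ^ 2 + d ^ 2) ^ 3) s := by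
  have hp : 0 < s ^ 2 + d ^ 2 := by positivity
  have h0 := (Real.sqrt_pos.2 hp).ne'
  have := (hasDerivAt_id s).div (((hasDerivAt_pow 2 s).add_const (d ^ 2)).sqrt hp.ne') h0
  refine this.congr_deriv ?_
  have h2 : √(s ^ 2 + d ^ 2) ^ 2 = s ^ 2 + d ^ 2 := Real.sq_sqrt hp.le
  simp only [id]
  field_simp
  push_cast
  rw [h2]
  ring

theorem contDiff_smoothAbs (hd : 0 < d) {n : WithTop ℕ∞} : ContDiff ℝ n (smoothAbs d) :=
  (ContDiff.sqrt (by fun_prop) fun s => by positivity).sub contDiff_const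

theorem continuous_smoothSign (hd : 0 < d) : Continuous (smoothSign d) :=
  continuous_iff_continuousAt.2 fun s => (hasDerivAt_smoothSign hd s).continuousAt

theorem abs_smoothSign_le (hd : 0 < d) (s : ℝ) : |smoothSign d s| ≤ 1 := by
  have hp : 0 < s ^ 2 + d ^ 2 := by positivity
  rw [smoothSign, abs_div, abs_of_pos (Real.sqrt_pos.2 hp), div_le_one (Real.sqrt_pos.2 hp)]
  exact Real.abs_le_sqrt (by nlinarith)

theorem abs_smoothAbs_sub_le (hd : 0 < d) (s t : ℝ) : |smoothAbs d s - smoothAbs d t| ≤ |s - t| := by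
  have := Convex.norm_image_sub_le_of_norm_hasDerivWithin_le (f := smoothAbs d)
    (f' := smoothSign d) (C := 1) (s := univ) (x := t) (y := s)
    (fun x _ => (hasDerivAt_smoothAbs hd x).hasDerivWithinAt)
    (fun x _ => abs_smoothSign_le hd x) convex_univ (mem_univ _) (mem_univ _)
  simpa using this

theorem abs_smoothAbs_le (hd : 0 < d) (s : ℝ) : |smoothAbs d s| ≤ |s| := by
  have h0 : smoothAbs d 0 = 0 := by simp [smoothAbs, Real.sqrt_sq hd.le]
  simpa [h0] using abs_smoothAbs_sub_le hd s 0

theorem tendsto_smoothAbs (s : ℝ) :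
    Tendsto (fun n : ℕ => smoothAbs (1 / ((n : ℝ) + 1)) s) atTop (𝓝 |s|) := by
  have hc : Continuous fun d : ℝ => smoothAbs d s := by unfold smoothAbs; fun_prop
  have := (hc.tendsto 0).comp tendsto_one_div_add_atTop_nhds_zero_nat
  simpa [smoothAbs, Real.sqrt_sq_eq_abs, Function.comp_def] using this

/-- At `s = 0` every term is `0`, in agreement with the convention `0 / 0 = 0`; the limit is
therefore the sign with value `0` at `0`. -/
theorem tendsto_smoothSign (s : ℝ) :
    Tendsto (fun n : ℕ => smoothSign (1 / ((n : ℝ) + 1)) s) atTop (𝓝 (s / |s|)) := by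
  rcases eq_or_ne s 0 with rfl | hs
  · simp [smoothSign]
  have hc : ContinuousAt (fun d : ℝ => smoothSign d s) 0 := by
    unfold smoothSign
    refine ContinuousAt.div (by fun_prop) (by fun_prop) ?_
    have : 0 < s ^ 2 + 0 ^ 2 := by positivity
    exact (Real.sqrt_pos.2 this).ne'
  have := hc.tendsto.comp tendsto_one_div_add_atTop_nhds_zero_nat
  simpa [smoothSign, Real.sqrt_sq_eq_abs, Function.comp_def] using this

end SmoothAbs

/-! ### Kato's inequality for distributional Laplacians -/

section Kato

variable {N : ℕ} {U : Set (EuclideanSpace ℝ (Fin N))} {u g ψ : EuclideanSpace ℝ (Fin N) → ℝ}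

/-- `Δ u = g` in the sense of distributions on `U`. -/
def HasWeakLaplacian (U : Set (EuclideanSpace ℝ (Fin N))) (u g : EuclideanSpace ℝ (Fin N) → ℝ) :
    Prop :=
  ∀ φ : EuclideanSpace ℝ (Fin N) → ℝ, ContDiff ℝ (⊤ : ℕ∞) φ → HasCompactSupport φ →
    tsupport φ ⊆ U → ∫ x, u x * laplaceSum φ x = ∫ x, g x * φ x

theorem contDiff_two_of_top {f : EuclideanSpace ℝ (Fin N) → ℝ}
    (hf : ContDiff ℝ (⊤ : ℕ∞) f) : ContDiff ℝ 2 f :=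
  contDiff_infty.1 hf 2

theorem continuous_laplaceSum {f : EuclideanSpace ℝ (Fin N) → ℝ} (hf : ContDiff ℝ 2 f) :
    Continuous (laplaceSum f) :=
  (contDiff_laplaceSum hf (m := 0) (by norm_num)).continuous

theorem hasCompactSupport_comp_const_sub {η : EuclideanSpace ℝ (Fin N) → ℝ}
    (hη : HasCompactSupport η) (x : EuclideanSpace ℝ (Fin N)) :
    HasCompactSupport fun y => η (x - y) :=
  hη.comp_homeomorph (Homeomorph.subLeft x)

/-- The Laplacian falls on the kernel, and the ball condition on `x` makes the reflected, translated
kernel an admissible test function. -/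
theorem HasWeakLaplacian.laplaceSum_mollify_kernel (hw : HasWeakLaplacian U u g)
    (hu : LocallyIntegrable u) {r : ℝ} (hr : 0 < r) (n : ℕ) {x : EuclideanSpace ℝ (Fin N)}
    (hx : Metric.closedBall x r ⊆ U) :
    laplaceSum (mollify (kernel N r hr n) u) x = mollify (kernel N r hr n) g x := by
  have hc := hasCompactSupport_kernel (N := N) hr n
  have hs : ContDiff ℝ (⊤ : ℕ∞) (kernel N r hr n) := contDiff_kernel hr n
  rw [laplaceSum_mollify hc (contDiff_two_of_top hs) hu]
  have := hw (fun y => kernel N r hr n (x - y)) (by fun_prop)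
    (hasCompactSupport_comp_const_sub hc x)
    ((tsupport_comp_const_sub_subset (tsupport_kernel hr n) x).trans hx)
  rw [laplaceSum_comp_const_sub (contDiff_two_of_top hs)] at this
  exact this

theorem exists_abs_le_of_hasCompactSupport (hψ : Continuous ψ) (hs : HasCompactSupport ψ) :
    ∃ C, ∀ x, |ψ x| ≤ C :=
  hs.exists_bound_of_continuous hψ

/-- For mollifications of `u` this is the chain rule for a convex function followed by integration
by parts. In the limit, the mollified `g` converges in `L¹` against a bounded factor converging
almost everywhere, and `smoothAbs d` preserves `L¹` convergence because it is 1-Lipschitz. -/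
theorem HasWeakLaplacian.integral_smoothSign_le (hU : IsOpen U) (hw : HasWeakLaplacian U u g)
    (hu : Integrable u) (hg : Integrable g) (hψ : ContDiff ℝ (⊤ : ℕ∞) ψ)
    (hs : HasCompactSupport ψ) (hsU : tsupport ψ ⊆ U) (h0 : ∀ x, 0 ≤ ψ x) {d : ℝ} (hd : 0 < d) :
    ∫ x, g x * (smoothSign d (u x) * ψ x) ≤ ∫ x, smoothAbs d (u x) * laplaceSum ψ x := by
  -- The mollification radius is chosen so that the mollified equation holds at every point of the
  -- support of `ψ`.
  obtain ⟨r, hr, hrU⟩ := IsCompact.exists_cthickening_subset_open hs hU hsU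
  have hψ2 := contDiff_two_of_top hψ
  have hΔc := continuous_laplaceSum hψ2
  have hΔs := hasCompactSupport_laplaceSum hs
  obtain ⟨C, hC⟩ := exists_abs_le_of_hasCompactSupport hψ.continuous hs
  obtain ⟨C', hC'⟩ := exists_abs_le_of_hasCompactSupport hΔc hΔs
  set un := fun n => mollify (kernel N r hr n) u with hun
  set gn := fun n => mollify (kernel N r hr n) g with hgn
  have hus : ∀ n, ContDiff ℝ 2 (un n) := fun n => contDiff_two_of_top
    (contDiff_mollify (hasCompactSupport_kernel hr n) (contDiff_kernel hr n) hu.locallyIntegrable)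
  have hui : ∀ n, Integrable (un n) := fun n => integrable_mollify (integrable_kernel hr n) hu
  have hgi : ∀ n, Integrable (gn n) := fun n => integrable_mollify (integrable_kernel hr n) hg
  have hjc : Continuous (smoothAbs d) := (contDiff_smoothAbs hd (n := 0)).continuous
  have hji : ∀ f : EuclideanSpace ℝ (Fin N) → ℝ, Integrable f →
      Integrable fun x => smoothAbs d (f x) := fun f hf =>
    hf.mono (hjc.comp_aestronglyMeasurable hf.aestronglyMeasurable)
      (Eventually.of_forall fun x => abs_smoothAbs_le hd (f x))
  have hn : ∀ n, ∫ x, gn n x * (smoothSign d (un n x) * ψ x) ≤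
      ∫ x, smoothAbs d (un n x) * laplaceSum ψ x := by
    intro n
    have hjf : ContDiff ℝ 2 fun x => smoothAbs d (un n x) := (contDiff_smoothAbs hd).comp (hus n)
    have hsc : Continuous fun x => smoothSign d (un n x) :=
      (continuous_smoothSign hd).comp (hus n).continuous
    rw [integral_mul_laplaceSum hjf hψ2 hs]
    have e : ∀ x, gn n x * (smoothSign d (un n x) * ψ x) =
        smoothSign d (un n x) * laplaceSum (un n) x * ψ x := by
      intro x
      by_cases hx : x ∈ tsupport ψ
      · have : Metric.closedBall x r ⊆ U :=
          (Metric.closedBall_subset_cthickening hx r).trans hrU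
        rw [hun, hgn]
        simp only
        rw [hw.laplaceSum_mollify_kernel hu.locallyIntegrable hr n this]
        ring
      · rw [image_eq_zero_of_notMem_tsupport hx]; ring
    simp only [e]
    refine integral_mono
      (integrable_mul_of_hasCompactSupport (hsc.mul (continuous_laplaceSum (hus n)))
        hψ.continuous hs)
      (integrable_mul_of_hasCompactSupport (continuous_laplaceSum hjf) hψ.continuous hs)
      fun x => ?_
    exact mul_le_mul_of_nonneg_right (mul_laplaceSum_le_laplaceSum_comp
      (hasDerivAt_smoothAbs hd) (hasDerivAt_smoothSign hd) (fun s => by positivity) (hus n) x)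
      (h0 x)
  have hae := ae_tendsto_mollify hr hu.locallyIntegrable
  have hL1 := tendsto_integral_abs_mollify_sub hr hu
  have l1 : Tendsto (fun n => ∫ x, gn n x * (smoothSign d (un n x) * ψ x)) atTop
      (𝓝 (∫ x, g x * (smoothSign d (u x) * ψ x))) := by
    refine tendsto_integral_mul (C := C) hgi hg (tendsto_integral_abs_mollify_sub hr hg)
      (fun n => ?_) (fun n x => ?_) ?_
    · exact (((continuous_smoothSign hd).comp (hus n).continuous).mul
        hψ.continuous).aestronglyMeasurable
    · rw [abs_mul]
      calc |smoothSign d (un n x)| * |ψ x| ≤ 1 * |ψ x| := by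
            gcongr; exact abs_smoothSign_le hd _
        _ ≤ C := by rw [one_mul]; exact hC x
    · filter_upwards [hae] with x hx
      exact (((continuous_smoothSign hd).tendsto (u x)).comp hx).mul_const _
  have l2 : Tendsto (fun n => ∫ x, smoothAbs d (un n x) * laplaceSum ψ x) atTop
      (𝓝 (∫ x, smoothAbs d (u x) * laplaceSum ψ x)) := by
    refine tendsto_integral_mul (b := fun _ => laplaceSum ψ) (C := C') (fun n => hji _ (hui n))
      (hji _ hu) ?_ (fun n => hΔc.aestronglyMeasurable) (fun n x => hC' x)
      (Eventually.of_forall fun x => tendsto_const_nhds)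
    refine squeeze_zero (fun n => integral_nonneg fun x => abs_nonneg _) (fun n => ?_) hL1
    exact integral_mono ((hji _ (hui n)).sub (hji _ hu)).abs ((hui n).sub hu).abs
      fun x => abs_smoothAbs_sub_le hd _ _
  exact le_of_tendsto_of_tendsto' l1 l2 hn

/-- Kato's inequality: `Δ |u| ≥ sign(u) Δ u` in the sense of distributions. -/
theorem HasWeakLaplacian.kato (hU : IsOpen U) (hw : HasWeakLaplacian U u g)
    (hu : Integrable u) (hg : Integrable g) (hψ : ContDiff ℝ (⊤ : ℕ∞) ψ)
    (hs : HasCompactSupport ψ) (hsU : tsupport ψ ⊆ U) (h0 : ∀ x, 0 ≤ ψ x) :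
    ∫ x, g x * (u x / |u x| * ψ x) ≤ ∫ x, |u x| * laplaceSum ψ x := by
  have hΔc := continuous_laplaceSum (contDiff_two_of_top hψ)
  obtain ⟨C, hC⟩ := exists_abs_le_of_hasCompactSupport hψ.continuous hs
  obtain ⟨C', hC'⟩ := exists_abs_le_of_hasCompactSupport hΔc (hasCompactSupport_laplaceSum hs)
  have hd : ∀ n : ℕ, (0 : ℝ) < 1 / ((n : ℝ) + 1) := fun n => by positivity
  have l1 : Tendsto (fun n : ℕ => ∫ x, g x * (smoothSign (1 / ((n : ℝ) + 1)) (u x) * ψ x)) atTop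
      (𝓝 (∫ x, g x * (u x / |u x| * ψ x))) := by
    refine tendsto_integral_mul (a := fun _ => g) (C := C) (fun _ => hg) hg (by simp)
      (fun n => ?_) (fun n x => ?_) ?_
    · exact ((continuous_smoothSign (hd n)).comp_aestronglyMeasurable
        hu.aestronglyMeasurable).mul hψ.continuous.aestronglyMeasurable
    · rw [abs_mul]
      calc _ ≤ 1 * |ψ x| := by gcongr; exact abs_smoothSign_le (hd n) _
        _ ≤ C := by rw [one_mul]; exact hC x
    · exact Eventually.of_forall fun x => (tendsto_smoothSign (u x)).mul_const _
  have l2 : Tendsto (fun n : ℕ => ∫ x, smoothAbs (1 / ((n : ℝ) + 1)) (u x) * laplaceSum ψ x) atTop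
      (𝓝 (∫ x, |u x| * laplaceSum ψ x)) := by
    refine tendsto_integral_of_dominated_convergence (fun x => |u x| * C')
      (fun n => ?_) (hu.abs.mul_const _) (fun n => ?_) ?_
    · exact ((contDiff_smoothAbs (hd n) (n := 0)).continuous.comp_aestronglyMeasurable
        hu.aestronglyMeasurable).mul hΔc.aestronglyMeasurable
    · refine Eventually.of_forall fun x => ?_
      rw [Real.norm_eq_abs, abs_mul]
      exact mul_le_mul (abs_smoothAbs_le (hd n) _) (hC' x) (abs_nonneg _) (abs_nonneg _)
    · exact Eventually.of_forall fun x => (tendsto_smoothAbs (u x)).mul_const _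
  exact le_of_tendsto_of_tendsto' l1 l2 fun n =>
    hw.integral_smoothSign_le hU hu hg hψ hs hsU h0 (hd n)

end Kato

/-! ### The distance to the boundary -/

section Distance

variable {N : ℕ} {Ω : Set (EuclideanSpace ℝ (Fin N))} {x y : EuclideanSpace ℝ (Fin N)}

theorem frontier_nonempty (hΩ : Ω ≠ univ) (hx : x ∈ Ω) : (frontier Ω).Nonempty :=
  nonempty_frontier_iff.2 ⟨⟨x, hx⟩, hΩ⟩

theorem rho_pos (hO : IsOpen Ω) (hΩ : Ω ≠ univ) (hx : x ∈ Ω) : 0 < rho Ω x := by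
  refine (isClosed_frontier.notMem_iff_infDist_pos (frontier_nonempty hΩ hx)).1 fun h => ?_
  rw [hO.frontier_eq] at h
  exact h.2 hx

/-- The distance from `x` to the complement is attained at a frontier point, so no point outside `Ω`
is closer than `ρ(x)`. -/
theorem ball_rho_subset (hx : x ∈ Ω) : Metric.ball x (rho Ω x) ⊆ Ω := by
  intro y hy
  by_contra hn
  obtain ⟨z, hz, hz'⟩ := exists_mem_frontier_infDist_compl_eq_dist hx fun h => hn (h ▸ mem_univ y)
  have h1 : rho Ω x ≤ dist x z := Metric.infDist_le_dist_of_mem hz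
  have h2 : Metric.infDist x Ωᶜ ≤ dist x y := Metric.infDist_le_dist_of_mem hn
  rw [Metric.mem_ball, dist_comm] at hy
  linarith

theorem rho_le_add_dist : rho Ω x ≤ rho Ω y + dist x y :=
  Metric.infDist_le_infDist_add_dist

end Distance

/-! ### From distributional solutions to smooth subsolutions -/

section Subsolution

variable {N : ℕ} {h : ℝ → ℝ} {α : ℝ} {Ω : Set (EuclideanSpace ℝ (Fin N))}
  {u : EuclideanSpace ℝ (Fin N) → ℝ}

/-- The supporting line of the convex `h` at `s`. Integrated against a probability kernel with mean
`s`, it yields Jensen's inequality without requiring `h(k|v|)` to be integrable. -/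
theorem IsNonlinearity.tangent_le (hh : IsNonlinearity h) {s t : ℝ} (hs : 0 < s) (ht : 0 ≤ t) :
    h s + deriv h s * (t - s) ≤ h t := by
  have hd : HasDerivAt h (deriv h s) s :=
    (hh.contDiff.differentiable one_ne_zero s).hasDerivAt
  rcases lt_trichotomy s t with hst | rfl | hst
  · have := hh.convexOn.le_slope_of_hasDerivAt (mem_Ici.2 hs.le) (mem_Ici.2 ht) hst hd
    rw [slope_def_field, le_div_iff₀ (by linarith)] at this
    linarith
  · simp
  · have := hh.convexOn.slope_le_of_hasDerivAt (mem_Ici.2 ht) (mem_Ici.2 hs.le) hst hd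
    rw [slope_def_field, div_le_iff₀ (by linarith)] at this
    linarith

theorem IsNonlinearity.map_mul_div_abs (hh : IsNonlinearity h) {a : ℝ} (t : ℝ) :
    h (a * t) * (t / |t|) = h (a * |t|) := by
  rcases lt_trichotomy t 0 with ht | rfl | ht
  · rw [abs_of_neg ht, mul_neg, hh.odd, div_neg, div_self ht.ne]; ring
  · simp [hh.map_zero]
  · rw [abs_of_pos ht, div_self ht.ne', mul_one]

/-- The power `-2 - α` is negative, so its factor is smallest at the upper bound for `ρ`; inside the
monotone `h` the positive power `α` calls for the lower bound. -/
theorem IsNonlinearity.le_absorption_mul_sign (hh : IsNonlinearity h) (hα : 0 < α)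
    {r : ℝ} (hr : 0 < r) {x : EuclideanSpace ℝ (Fin N)} (h1 : r / 2 ≤ rho Ω x)
    (h2 : rho Ω x ≤ 3 * r / 2) (t : ℝ) :
    (3 * r / 2) ^ (-2 - α) * h ((r / 2) ^ α * |t|) ≤ absorption Ω α h x t * (t / |t|) := by
  have hp : 0 < rho Ω x := by linarith
  rw [absorption, mul_assoc, hh.map_mul_div_abs]
  have h3 : (r / 2) ^ α * |t| ≤ rho Ω x ^ α * |t| := by gcongr
  have h4 : 0 ≤ (r / 2) ^ α * |t| := by positivity
  refine mul_le_mul ?_ (hh.monotoneOn (mem_Ici.2 h4) (mem_Ici.2 (h4.trans h3)) h3)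
    (hh.nonneg h4) (by positivity)
  exact Real.rpow_le_rpow_of_nonpos hp h2 (by linarith)

/-- Restricting a solution to a ball compactly contained in `Ω`. -/
theorem IsSolution.hasWeakLaplacian {g : EuclideanSpace ℝ (Fin N) → ℝ → ℝ}
    (hO : IsOpen Ω) (hu : IsSolution Ω g u) {B : Set (EuclideanSpace ℝ (Fin N))} (hB : B ⊆ Ω)
    (hi : Integrable (B.indicator u)) (hgi : Integrable (B.indicator fun x => g x (u x))) :
    HasWeakLaplacian B (B.indicator u) (B.indicator fun x => g x (u x)) := by
  intro φ hφ hs hsB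
  have h0 := hu.integral_eq_zero φ hφ hs (hsB.trans hB)
  have hφ2 := contDiff_two_of_top hφ
  have hb : ∀ {p ψ : EuclideanSpace ℝ (Fin N) → ℝ}, Integrable p → Continuous ψ →
      HasCompactSupport ψ → Integrable fun x => p x * ψ x := fun {p ψ} hp hψ hψs => by
    obtain ⟨C, hC⟩ := exists_abs_le_of_hasCompactSupport hψ hψs
    exact hp.mul_bdd hψ.aestronglyMeasurable (Eventually.of_forall hC)
  rw [laplacian_eq_laplaceSum hφ2, ← integral_indicator hO.measurableSet] at h0
  have e : Ω.indicator (fun x => -(u x * laplaceSum φ x) + g x (u x) * φ x) =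
      fun x => B.indicator (fun x => g x (u x)) x * φ x - B.indicator u x * laplaceSum φ x := by
    funext x
    by_cases hx : x ∈ B
    · rw [indicator_of_mem (hB hx), indicator_of_mem hx, indicator_of_mem hx]; ring
    · have h1 : φ x = 0 := image_eq_zero_of_notMem_tsupport fun hn => hx (hsB hn)
      have h2 : laplaceSum φ x = 0 := image_eq_zero_of_notMem_tsupport fun hn =>
        hx (hsB (tsupport_laplaceSum_subset hn))
      simp [indicator, h1, h2]
  rw [e, integral_sub (hb hgi hφ.continuous hs)
    (hb hi (continuous_laplaceSum hφ2) (hasCompactSupport_laplaceSum hs))] at h0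
  linarith

/-- Mollifying the absolute value of a distributional solution gives a smooth subsolution: if
`g sign(u) ≥ A h(κ|u|)`, then `V = κ|u| ⋆ η` satisfies `Δ V ≥ κ A h(V)` wherever `V > 0`. -/
theorem IsNonlinearity.mul_map_le_laplaceSum_mollify (hh : IsNonlinearity h)
    {B : Set (EuclideanSpace ℝ (Fin N))} (hB : IsOpen B) {v g : EuclideanSpace ℝ (Fin N) → ℝ}
    (hv : Integrable v) (hg : Integrable g) (hw : HasWeakLaplacian B v g)
    {A k : ℝ} (hA : 0 ≤ A) (hk : 0 ≤ k) (hgv : ∀ x, A * h (k * |v x|) ≤ g x * (v x / |v x|))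
    {r : ℝ} (hr : 0 < r) (n : ℕ) {x : EuclideanSpace ℝ (Fin N)}
    (hx : Metric.closedBall x r ⊆ B)
    (hpos : 0 < mollify (kernel N r hr n) (fun y => k * |v y|) x) :
    k * A * h (mollify (kernel N r hr n) (fun y => k * |v y|) x) ≤
      laplaceSum (mollify (kernel N r hr n) fun y => k * |v y|) x := by
  set η := kernel N r hr n with hη
  set s := mollify η (fun y => k * |v y|) x with hs
  have hc : HasCompactSupport η := hasCompactSupport_kernel hr n
  have hsm : ContDiff ℝ (⊤ : ℕ∞) η := contDiff_kernel hr n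
  have hψs : HasCompactSupport fun y => η (x - y) := hasCompactSupport_comp_const_sub hc x
  have hψc : Continuous fun y => η (x - y) := hsm.continuous.comp (by fun_prop)
  obtain ⟨C, hC⟩ := exists_abs_le_of_hasCompactSupport hψc hψs
  have hkv : Integrable fun y => k * |v y| := hv.abs.const_mul k
  have hkato := hw.kato hB hv hg (ψ := fun y => η (x - y)) (by fun_prop) hψs
    ((tsupport_comp_const_sub_subset (tsupport_kernel hr n) x).trans hx)
    (fun y => kernel_nonneg hr n _)
  rw [laplaceSum_comp_const_sub (contDiff_two_of_top hsm)] at hkato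
  rw [laplaceSum_mollify hc (contDiff_two_of_top hsm) hkv.locallyIntegrable]
  have e1 : mollify (laplaceSum η) (fun y => k * |v y|) x =
      k * ∫ y, |v y| * laplaceSum η (x - y) := by
    rw [mollify, ← integral_const_mul]
    exact integral_congr_ae (Eventually.of_forall fun y => by ring)
  rw [e1, mul_assoc]
  refine mul_le_mul_of_nonneg_left (le_trans ?_ hkato) hk
  have i1 : Integrable fun y => k * |v y| * η (x - y) :=
    integrable_mul_kernel hc hsm.continuous hkv.locallyIntegrable x
  have i2 : Integrable fun y => η (x - y) := (integrable_kernel hr n).comp_sub_left x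
  have e2 : ∫ y, η (x - y) = 1 := by
    rw [integral_sub_left_eq_self η volume x]; exact integral_kernel hr n
  have i3 : Integrable fun y => g y * (v y / |v y| * η (x - y)) := by
    have hm : AEStronglyMeasurable (fun y => v y / |v y|) volume :=
      (hv.aestronglyMeasurable.aemeasurable.div
        hv.abs.aestronglyMeasurable.aemeasurable).aestronglyMeasurable
    refine hg.mul_bdd (c := C) (hm.mul hψc.aestronglyMeasurable)
      (Eventually.of_forall fun y => ?_)
    rw [Real.norm_eq_abs, abs_mul, abs_div, abs_abs]
    calc _ ≤ 1 * |η (x - y)| := by gcongr; exact div_self_le_one _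
      _ ≤ C := by rw [one_mul]; exact hC y
  set m := deriv h s
  -- The tangent line at `s` averages to exactly `h s`, because the kernel has mass one and `s` is
  -- the average of `k * |v|`.
  have e3 : ∫ y, A * ((h s - m * s) * η (x - y) + m * (k * |v y| * η (x - y))) = A * h s := by
    rw [integral_const_mul, integral_add (i2.const_mul _) (i1.const_mul _), integral_const_mul,
      integral_const_mul, e2]
    have : ∫ y, k * |v y| * η (x - y) = s := rfl
    rw [this]; ring
  rw [← e3]
  refine integral_mono (((i2.const_mul _).add (i1.const_mul _)).const_mul A) i3 fun y => ?_
  have ht := hh.tangent_le hpos (mul_nonneg hk (abs_nonneg (v y)))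
  have h1 : 0 ≤ η (x - y) := kernel_nonneg hr n _
  calc A * ((h s - m * s) * η (x - y) + m * (k * |v y| * η (x - y)))
      = A * (h s + m * (k * |v y| - s)) * η (x - y) := by ring
    _ ≤ A * h (k * |v y|) * η (x - y) := by gcongr
    _ ≤ g y * (v y / |v y|) * η (x - y) := mul_le_mul_of_nonneg_right (hgv y) h1
    _ = g y * (v y / |v y| * η (x - y)) := by ring

end Subsolution

/-! ### Scaling and the local bound -/

section Main

variable {N : ℕ} {h : ℝ → ℝ} {α : ℝ}

/-- The powers `r^α` and `r^(-2-α)` combine to `r^(-2)`, so `k A` has the form `c / R²` with `c`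
independent of `r`. The `36` compensates for working with `R = r / 6`. -/
theorem scaling_identity {r : ℝ} (hr : 0 < r) :
    (2 : ℝ) ^ (-α) * (3 / 2) ^ (-2 - α) / 36 / (r / 6) ^ 2 =
      (r / 2) ^ α * (3 * r / 2) ^ (-2 - α) := by
  rw [show 3 * r / 2 = 3 / 2 * r by ring, Real.mul_rpow (by norm_num) hr.le,
    Real.div_rpow hr.le (by norm_num), Real.rpow_neg (by norm_num : (0 : ℝ) ≤ 2),
    show r ^ (-2 - α) = (r ^ 2)⁻¹ * (r ^ α)⁻¹ by
      rw [sub_eq_add_neg, Real.rpow_add hr, Real.rpow_neg hr.le, Real.rpow_neg hr.le,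
        Real.rpow_two]]
  have h1 : (r : ℝ) ^ α ≠ 0 := (Real.rpow_pos_of_pos hr α).ne'
  have h2 : (2 : ℝ) ^ α ≠ 0 := (Real.rpow_pos_of_pos two_pos α).ne'
  field_simp
  norm_num

/-- The a priori bound on a ball around a point of `Ω`. -/
theorem IsNonlinearity.ae_abs_le_of_center_bound (hh : IsNonlinearity h) (hα : 0 < α) {M : ℝ}
    (hM : ∀ (R : ℝ) (x₀ : EuclideanSpace ℝ (Fin N))
      (V : EuclideanSpace ℝ (Fin N) → ℝ), 0 < R → ContDiff ℝ 2 V →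
      (∀ x ∈ Metric.ball x₀ R, 1 < V x →
        (2 : ℝ) ^ (-α) * (3 / 2) ^ (-2 - α) / 36 / R ^ 2 * h (V x) ≤ laplaceSum V x) → V x₀ ≤ M)
    {Ω : Set (EuclideanSpace ℝ (Fin N))} (hO : IsOpen Ω) (hΩ : Ω ≠ univ)
    {u : EuclideanSpace ℝ (Fin N) → ℝ} (hu : IsSolution Ω (absorption Ω α h) u)
    {x₁ : EuclideanSpace ℝ (Fin N)} (hx₁ : x₁ ∈ Ω) :
    ∀ᵐ x, x ∈ Metric.ball x₁ (rho Ω x₁ / 6) → (rho Ω x₁ / 2) ^ α * |u x| ≤ M := by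
  have hr := rho_pos hO hΩ hx₁
  set r := rho Ω x₁ with hr_def
  have hr6 : 0 < r / 6 := by positivity
  set B := Metric.ball x₁ (r / 2) with hB
  have hBc : Metric.closedBall x₁ (r / 2) ⊆ Ω :=
    (Metric.closedBall_subset_ball (half_lt_self hr)).trans (ball_rho_subset hx₁)
  have hBΩ : B ⊆ Ω := Metric.ball_subset_closedBall.trans hBc
  have hind : ∀ {p : EuclideanSpace ℝ (Fin N) → ℝ}, LocallyIntegrableOn p Ω →
      Integrable (B.indicator p) := fun {p} hp =>
    ((hp.integrableOn_compact_subset hBc (isCompact_closedBall _ _)).mono_set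
      Metric.ball_subset_closedBall).integrable_indicator measurableSet_ball
  have hv := hind hu.locallyIntegrableOn
  have hg := hind hu.locallyIntegrableOn_comp
  have hw := hu.hasWeakLaplacian hO hBΩ hv hg
  set v := B.indicator u with hvdef
  set k := (r / 2) ^ α with hk
  set A := (3 * r / 2) ^ (-2 - α) with hA
  have hk0 : 0 < k := by positivity
  have hA0 : 0 ≤ A := by positivity
  have hgv : ∀ x, A * h (k * |v x|) ≤
      B.indicator (fun x => absorption Ω α h x (u x)) x * (v x / |v x|) := by
    intro x
    by_cases hx : x ∈ B
    · rw [hvdef, indicator_of_mem hx, indicator_of_mem hx]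
      have hd := Metric.mem_ball.1 hx
      have h1 := rho_le_add_dist (Ω := Ω) (x := x) (y := x₁)
      have h2 := rho_le_add_dist (Ω := Ω) (x := x₁) (y := x)
      rw [dist_comm] at h2
      exact hh.le_absorption_mul_sign hα hr (by linarith) (by linarith) (u x)
    · rw [hvdef, indicator_of_notMem hx, indicator_of_notMem hx]
      simp [hh.map_zero]
  have hkv : Integrable fun y => k * |v y| := hv.abs.const_mul k
  -- Three steps of length `r / 6` have to fit into `r / 2`: from `x₁` to `x`, from `x` to a point
  -- of the comparison ball, and from there across the mollifier's support.
  have hbound : ∀ n, ∀ x ∈ Metric.ball x₁ (r / 6),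
      mollify (kernel N (r / 6) hr6 n) (fun y => k * |v y|) x ≤ M := by
    intro n x hx
    refine hM (r / 6) x _ hr6 (contDiff_two_of_top (contDiff_mollify
      (hasCompactSupport_kernel hr6 n) (contDiff_kernel hr6 n) hkv.locallyIntegrable))
      fun z hz h1 => ?_
    rw [scaling_identity hr]
    refine hh.mul_map_le_laplaceSum_mollify Metric.isOpen_ball hv hg hw hA0 hk0.le hgv hr6 n
      (fun y hy => ?_) (zero_lt_one.trans h1)
    rw [Metric.mem_ball] at *
    rw [Metric.mem_closedBall] at hy
    have t1 := dist_triangle y z x₁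
    have t2 := dist_triangle z x x₁
    linarith
  filter_upwards [ae_tendsto_mollify hr6 hkv.locallyIntegrable] with x hx hxB
  have h1 := le_of_tendsto' hx fun n => hbound n x hxB
  rwa [hvdef, indicator_of_mem (Metric.ball_subset_ball (by linarith) hxB)] at h1

end Main

end SimilarityElliptic

theorem lemma3p1 (N : ℕ) (hN : 1 < N) (α : ℝ) (hα : 0 < α) (h : ℝ → ℝ)
    (hh : SimilarityElliptic.IsNonlinearity h) (hKO : SimilarityElliptic.KellerOsserman h) :
    ∃ C : ℝ, 0 < C ∧
      ∀ Ω : Set (EuclideanSpace ℝ (Fin N)), IsOpen Ω → Ω ≠ Set.univ →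
        ∀ u : EuclideanSpace ℝ (Fin N) → ℝ,
          SimilarityElliptic.IsSolution Ω (SimilarityElliptic.absorption Ω α h) u →
            ∀ᵐ x ∂(volume.restrict Ω), |u x| ≤ C * SimilarityElliptic.rho Ω x ^ (-α) := by
  obtain ⟨M, hM0, hM⟩ := hh.exists_center_bound hKO N
    (c := (2 : ℝ) ^ (-α) * (3 / 2) ^ (-2 - α) / 36) (by positivity)
  refine ⟨M * 4 ^ α, by positivity, fun Ω hO hΩ u hu => ?_⟩
  rw [ae_restrict_iff' hO.measurableSet, ae_iff]
  -- The local bounds hold almost everywhere on balls about every point; it suffices that the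
  -- exceptional set is null near each of its points.
  refine measure_null_of_locally_null _ fun x₁ hx₁ => ?_
  simp only [Classical.not_imp, mem_ofPred_eq] at hx₁
  have hr := SimilarityElliptic.rho_pos hO hΩ hx₁.1
  have hb := hh.ae_abs_le_of_center_bound hα hM hO hΩ hu hx₁.1
  set r := SimilarityElliptic.rho Ω x₁
  refine ⟨_, inter_mem_nhdsWithin _ (Metric.ball_mem_nhds x₁ (by positivity : 0 < r / 6)), ?_⟩
  refine measure_mono_null (fun x hx => ?_) (ae_iff.1 hb)
  obtain ⟨hx, hxB⟩ := hx
  simp only [Classical.not_imp, mem_ofPred_eq] at hx ⊢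
  refine ⟨hxB, fun hle => hx.2 ?_⟩
  have hρ := SimilarityElliptic.rho_pos hO hΩ hx.1
  have h1 := SimilarityElliptic.rho_le_add_dist (Ω := Ω) (x := x) (y := x₁)
  have h2 := Metric.mem_ball.1 hxB
  -- On the small ball `ρ(x) ≤ 7r/6 ≤ 2r`, which passes from the weight at the centre to the weight
  -- at `x` and accounts for the factor `4 ^ α` in the constant.
  have h3 : SimilarityElliptic.rho Ω x / 4 ≤ r / 2 := by
    have : SimilarityElliptic.rho Ω x ≤ r + dist x x₁ := h1
    linarith
  have h4 : (SimilarityElliptic.rho Ω x / 4) ^ α * |u x| ≤ M :=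
    le_trans (by gcongr) hle
  rw [Real.div_rpow hρ.le (by norm_num)] at h4
  rw [Real.rpow_neg hρ.le, ← div_eq_mul_inv, le_div_iff₀ (by positivity)]
  have h5 : (0 : ℝ) < 4 ^ α := by positivity
  calc |u x| * SimilarityElliptic.rho Ω x ^ α
      = (SimilarityElliptic.rho Ω x ^ α / 4 ^ α * |u x|) * 4 ^ α := by field_simp
    _ ≤ M * 4 ^ α := by gcongr
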